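/- There are $N\ge 3$ players, labeled $1,\dots,N$ and arranged in a circle (player $0$ is player $N$ and player $N+1$ is player $1$). Each player has a status $x_i\in\{0,1\}$ ($0$ = loser, $1$ = winner). At each turn one player $i$, chosen uniformly at random (except that the first player to play may be chosen in any way), tosses a coin. In game $B$, with parameters $p_0,p_1,p_2,p_3\in[0,1]$, the coin shows heads with probability $p_{m}$, where $m=2x_{i-1}+x_{i+1}$; in game $A$ the coin is fair. With heads the player wins one unit and his status becomes $1$; with tails he loses one unit and his status becomes $0$. Let $S_n$ be the total profit of all players in the first $n$ turns. For a given sequence of games, the mean profit per turn to the ensemble is the constant $\mu$ such that, for every initial distribution (of the statuses and of the first player to play), $S_n/n\to\mu$ almost surely. Denote it by $\mu_B^N$ if game $B$ is always played, and by $\mu_{[r,s]}^N$ if the pattern $A^rB^s$ ($r$ turns of game $A$ followed by $s$ turns of game $B$; $r,s\ge1$) is played repeatedly. The Parrondo effect is present for the pattern $A^rB^s$ if $\mu_B^N\le 0$ and $\mu_{[r,s]}^N>0$. Let $p_0=1$, $p_1=p_2\in(1/2,1)$, and $p_3=0$. Then the mean profits $\mu_B^N$ ($N\ge3$) and $\mu_{[r,1]}^N$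 ($N\ge3$, $r\ge1$) exist, and $\mu_B^N=0$ for all even $N\ge4$, $\mu_B^N>0$ for all odd $N\ge3$, and $\mu_{[r,1]}^N>0$ for all $N\ge3$ and $r\ge1$. In particular, for all $N\ge3$ and $r\ge1$, the Parrondo effect is present for the pattern $A^rB^1$ if and only if $N$ is even. -/

import Mathlib

namespace CoopParrondo

/-- Statuses of the `N` players, who are arranged in a circle: `true` is winner (1), `false` is
loser (0). -/
abbrev Config (N : ℕ) : Type := Fin N → Bool

/-- The number `m_i(x) = 2 x_{i-1} + x_{i+1}` in `{0, 1, 2, 3}`, indices being cyclic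
(`finRotate N` is the cyclic shift `i ↦ i + 1`). -/
def nbhd {N : ℕ} (x : Config N) (i : Fin N) : Fin 4 :=
  2 * (if x ((finRotate N).symm i) then 1 else 0) + (if x (finRotate N i) then 1 else 0)

/-- The configuration `x^i`, equal to `x` except at the `i`th component. -/
def flip {N : ℕ} (x : Config N) (i : Fin N) : Config N := Function.update x i (!x i)

/-- A state `(x, i)`: `x` is the status of each player and `i` is the next player to play. -/
abbrev State (N : ℕ) : Type := Config N × Fin N

/-- One-step transition matrix of the game with parameter vector `p = (p₀, p₁, p₂, p₃)`: the player
`i` whose turn it is tosses a `p_{m_i(x)}`-coin, becomes a winner with heads and a loser with tails,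
and the next player to play is chosen uniformly at random. -/
noncomputable def transition (N : ℕ) (p : Fin 4 → ℝ) : Matrix (State N) (State N) ℝ :=
  fun a b =>
    if b.1 = flip a.1 a.2 then
      (N : ℝ)⁻¹ * (if a.1 a.2 then 1 - p (nbhd a.1 a.2) else p (nbhd a.1 a.2))
    else if b.1 = a.1 then
      (N : ℝ)⁻¹ * (if a.1 a.2 then p (nbhd a.1 a.2) else 1 - p (nbhd a.1 a.2))
    else 0

/-- Profit to the ensemble in a turn that leads from `a` to `b`: the player `a.2` who has just
played wins one unit if his toss made him a winner, and loses one unit if it made him a loser. -/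
def payoff {N : ℕ} (a b : State N) : ℝ := if b.1 a.2 then 1 else -1

/-- Parameter vector of game `A` (a fair coin is tossed whatever the neighbors' statuses). -/
noncomputable def gameA : Fin 4 → ℝ := fun _ => 1 / 2

/-- Always playing game `B`, the game with parameter vector `p`: the game of each turn. -/
def alwaysB (p : Fin 4 → ℝ) : ℕ → Fin 4 → ℝ := fun _ => p

/-- The nonrandom periodic pattern `A^r B^s`, repeated forever: the game of each turn. -/
noncomputable def pattern (r s : ℕ) (p : Fin 4 → ℝ) : ℕ → Fin 4 → ℝ :=
  fun n => if n % (r + s) < r then gameA else p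

/-- `X` is a (nonhomogeneous) Markov chain in the finite set `S`, with one-step transition matrices
`P 0, P 1, P 2, …` and arbitrary initial distribution. -/
structure IsMarkovChain {S Ω : Type} [MeasurableSpace S] [MeasurableSpace Ω]
    (ℙ : MeasureTheory.Measure Ω) (P : ℕ → Matrix S S ℝ) (X : ℕ → Ω → S) : Prop where
  measurable : ∀ n, Measurable (X n)
  step : ∀ (n : ℕ) (x : ℕ → S),
    ℙ.real {ω | ∀ k ≤ n + 1, X k ω = x k} =
      ℙ.real {ω | ∀ k ≤ n, X k ω = x k} * P n (x n) (x (n + 1))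

/-- The mean profit per turn to the ensemble of `N` players, who play the game with parameter vector
`game n` at turn `n + 1`, is `μ`: whatever the initial distribution, `S_n / n → μ` almost surely,
where `S_n` is the total profit of the first `n` turns. -/
def HasMeanProfit (N : ℕ) (game : ℕ → Fin 4 → ℝ) (μ : ℝ) : Prop :=
  ∀ (Ω : Type) [MeasurableSpace Ω] (ℙ : MeasureTheory.Measure Ω)
    [MeasureTheory.IsProbabilityMeasure ℙ] (X : ℕ → Ω → State N),
    IsMarkovChain ℙ (fun n => transition N (game n)) X →
      ∀ᵐ ω ∂ℙ, Filter.Tendsto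
        (fun n : ℕ => (∑ k ∈ Finset.range n, payoff (X k ω) (X (k + 1) ω)) / (n : ℝ))
        Filter.atTop (nhds μ)

/-- The Parrondo effect for the pattern `A^r B^s`: always playing game `B` is losing or fair, while
repeatedly playing the pattern is winning. -/
def ParrondoEffect (N : ℕ) (p : Fin 4 → ℝ) (r s : ℕ) : Prop :=
  ∃ μB μrs : ℝ, HasMeanProfit N (alwaysB p) μB ∧ HasMeanProfit N (pattern r s p) μrs ∧
    μB ≤ 0 ∧ 0 < μrs

end CoopParrondo

/-! Averaging over the next player and recording the phase of the pattern gives a homogeneous chain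
on `Config N × Fin (r + 1)`, whose expected profit in one turn is `drift`. Always playing `B` is the
case `r = 0`. If `drift = μ + v - Pv` (Poisson's equation, with `P` the Markov operator), then the
total profit minus `nμ` is, up to bounded terms, a sum of bounded centered increments, so `S_n / n →
μ` almost surely (`hasMeanProfit_of_poisson`).

The sign of `μ` becomes visible after a change of the function. In game `B` the drift equals twice
the loser excess plus `2p₁ - 1` times the discord. The loser excess has a closed one-step equation
in terms of itself and the drift, so phase-dependent multiples of it form a coboundary that cancels
it. What remains is `κ > 0` times the discord at the turns of `B` (`exists_drift_eq`), a nonnegative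
function.

Since a player in game `B` can always take the status opposite to his left neighbor's, a sweep
around the circle reaches an alternating pattern. For even `N` such configurations are frozen under
`B` and have no discord, so `μ = 0`. For odd `N` the pattern has a defect at the seam, and with
turns of `A` it can be disturbed. In both of these cases one fixed state is accessible from
everywhere and every closed set has a state with positive discord at a turn of `B`, so
`exists_poisson` and `poisson_const_pos` give `μ > 0`. -/

namespace CoopParrondo

/-! ### Poisson's equation for finite random mappings -/

section Poisson

variable {T I : Type} [Fintype I]

/-- The Markov operator that moves from `a` to `τ a i` with probability `w a i`. -/
def markovOp (w : T → I → ℝ) (τ : T → I → T) : (T → ℝ) →ₗ[ℝ] (T → ℝ) where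
  toFun v a := ∑ i, w a i * v (τ a i)
  map_add' u v := by ext a; simp [mul_add, Finset.sum_add_distrib]
  map_smul' c v := by
    ext a
    simp only [Pi.smul_apply, smul_eq_mul, RingHom.id_apply, Finset.mul_sum]
    exact Finset.sum_congr rfl fun i _ => by ring

/-- A set of states that the chain cannot leave. -/
def IsClosedSet (w : T → I → ℝ) (τ : T → I → T) (M : Set T) : Prop :=
  ∀ a ∈ M, ∀ i, 0 < w a i → τ a i ∈ M

variable {w : T → I → ℝ} {τ : T → I → T}

lemma markovOp_apply (v : T → ℝ) (a : T) : markovOp w τ v a = ∑ i, w a i * v (τ a i) := rfl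

lemma markovOp_le (hw : ∀ a i, 0 ≤ w a i) (hs : ∀ a, ∑ i, w a i = 1) {v : T → ℝ} {m : ℝ}
    (h : ∀ b, v b ≤ m) (a : T) : markovOp w τ v a ≤ m := by
  calc markovOp w τ v a ≤ ∑ i, w a i * m :=
        Finset.sum_le_sum fun i _ => mul_le_mul_of_nonneg_left (h _) (hw a i)
    _ = m := by rw [← Finset.sum_mul, hs, one_mul]

/-- Maximum principle: an average of values at most `m` reaches `m` only if every value of positive
weight equals `m`. -/
lemma isClosedSet_argmax (hw : ∀ a i, 0 ≤ w a i) (hs : ∀ a, ∑ i, w a i = 1) {v : T → ℝ} {m : ℝ}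
    (h : ∀ b, v b ≤ m) (hv : ∀ a, v a = m → m ≤ markovOp w τ v a) :
    IsClosedSet w τ {a | v a = m} := by
  intro a ha i hi
  have h0 : ∑ j, w a j * (m - v (τ a j)) ≤ 0 := by
    have : ∑ j, w a j * (m - v (τ a j)) = m - markovOp w τ v a := by
      simp only [mul_sub, Finset.sum_sub_distrib, ← Finset.sum_mul, hs, one_mul, markovOp_apply]
    rw [this]
    linarith [hv a ha]
  have h1 : ∀ j ∈ Finset.univ, 0 ≤ w a j * (m - v (τ a j)) := fun j _ =>
    mul_nonneg (hw a j) (sub_nonneg.2 (h _))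
  have h2 := (Finset.sum_eq_zero_iff_of_nonneg h1).1 (le_antisymm h0 (Finset.sum_nonneg h1)) i
    (Finset.mem_univ i)
  rcases mul_eq_zero.1 h2 with h3 | h3
  · exact absurd h3 hi.ne'
  · change v (τ a i) = m
    linarith

variable [Fintype T]

lemma le_zero_of_le_markovOp (hw : ∀ a i, 0 ≤ w a i) (hs : ∀ a, ∑ i, w a i = 1) {v : T → ℝ}
    {C : Set T} (hC : ∀ M : Set T, M.Nonempty → IsClosedSet w τ M → (M ∩ C).Nonempty)
    (hv : ∀ a, v a ≤ markovOp w τ v a) (h0 : ∀ a ∈ C, v a ≤ 0) (a : T) : v a ≤ 0 := by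
  have : Nonempty T := ⟨a⟩
  obtain ⟨m, hm⟩ := Finite.exists_max v
  obtain ⟨c, hc, hcC⟩ := hC {b | v b = v m} ⟨m, rfl⟩
    (isClosedSet_argmax hw hs hm fun b hb => hb ▸ hv b)
  exact (hm a).trans ((show v c = v m from hc) ▸ h0 c hcC)

lemma eq_zero_of_eq_markovOp (hw : ∀ a i, 0 ≤ w a i) (hs : ∀ a, ∑ i, w a i = 1) {v : T → ℝ}
    {C : Set T} (hC : ∀ M : Set T, M.Nonempty → IsClosedSet w τ M → (M ∩ C).Nonempty)
    (hv : ∀ a, v a = markovOp w τ v a) (h0 : ∀ a ∈ C, v a = 0) : v = 0 := by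
  ext a
  refine le_antisymm (le_zero_of_le_markovOp hw hs hC (fun b => (hv b).le)
    (fun b hb => (h0 b hb).le) a) ?_
  have := le_zero_of_le_markovOp (v := -v) hw hs hC
    (fun b => by rw [map_neg, Pi.neg_apply, Pi.neg_apply, ← hv b]) (fun b hb => by simp [h0 b hb]) a
  simpa using this

/-- If a state is accessible from every state, then Poisson's equation is solvable. -/
theorem exists_poisson (hw : ∀ a i, 0 ≤ w a i) (hs : ∀ a, ∑ i, w a i = 1) {z : T}
    (hz : ∀ M : Set T, M.Nonempty → IsClosedSet w τ M → z ∈ M) (f : T → ℝ) :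
    ∃ (μ : ℝ) (v : T → ℝ), ∀ a, f a = μ + v a - markovOp w τ v a := by
  have : Nonempty T := ⟨z⟩
  -- Adding the rank-one term `v z` removes the constants from the kernel of `1 - P`. At a maximum
  -- of `v`, `L v = 0` forces `v z ≤ 0`; the same for `-v` gives `v z = 0`. Hence `L` is injective,
  -- so surjective, and `v z` serves as `μ`.
  let L : (T → ℝ) →ₗ[ℝ] (T → ℝ) :=
    LinearMap.id - markovOp w τ + LinearMap.pi fun _ => LinearMap.proj z
  have hL : ∀ v a, L v a = v a - markovOp w τ v a + v z := fun v a => rfl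
  have hle : ∀ v : T → ℝ, L v = 0 → v z ≤ 0 := by
    intro v hv
    obtain ⟨m, hm⟩ := Finite.exists_max v
    have h1 := hL v m
    rw [hv, Pi.zero_apply] at h1
    linarith [markovOp_le (τ := τ) hw hs hm m]
  have hinj : Function.Injective L := by
    rw [← LinearMap.ker_eq_bot, LinearMap.ker_eq_bot']
    intro v hv
    have hvz : v z = 0 := by
      refine le_antisymm (hle v hv) ?_
      have := hle (-v) (by rw [map_neg, hv, neg_zero])
      simpa using this
    refine eq_zero_of_eq_markovOp (C := {z}) hw hs (fun M hM hcl => ⟨z, hz M hM hcl, rfl⟩) ?_ ?_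
    · intro a
      have h1 := hL v a
      rw [hv, Pi.zero_apply] at h1
      linarith
    · rintro a rfl
      exact hvz
  obtain ⟨v, rfl⟩ := LinearMap.injective_iff_surjective.1 hinj f
  exact ⟨v z, v, fun a => by rw [hL]; ring⟩

theorem poisson_const_pos [Nonempty T] (hw : ∀ a i, 0 ≤ w a i) (hs : ∀ a, ∑ i, w a i = 1)
    {f v : T → ℝ} {μ : ℝ} (hf : ∀ a, 0 ≤ f a)
    (hpos : ∀ M : Set T, M.Nonempty → IsClosedSet w τ M → ∃ a ∈ M, 0 < f a)
    (h : ∀ a, f a = μ + v a - markovOp w τ v a) : 0 < μ := by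
  by_contra! hμ
  -- If `μ ≤ 0`, then `v` is superharmonic, so its minimizers form a closed set. At a minimizer with
  -- `f > 0`, the equation gives `f ≤ μ`, a contradiction.
  obtain ⟨m, hm⟩ := Finite.exists_max (-v)
  have hsub : ∀ a, (-v) a ≤ markovOp w τ (-v) a := by
    intro a
    rw [map_neg, Pi.neg_apply, Pi.neg_apply]
    linarith [h a, hf a]
  obtain ⟨a, ha, hfa⟩ := hpos {b | (-v) b = (-v) m} ⟨m, rfl⟩
    (isClosedSet_argmax hw hs hm fun b hb => hb ▸ hsub b)
  have h1 := markovOp_le (τ := τ) hw hs hm a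
  have h2 : (-v) a = (-v) m := ha
  rw [← h2, map_neg, Pi.neg_apply, Pi.neg_apply] at h1
  linarith [h a]

/-- Poisson's equation with constant `0`, for a function that vanishes on a closed set accessible
from every state. -/
theorem exists_poisson_of_eq_zero (hw : ∀ a i, 0 ≤ w a i) (hs : ∀ a, ∑ i, w a i = 1) {C : Set T}
    (hcl : IsClosedSet w τ C)
    (hC : ∀ M : Set T, M.Nonempty → IsClosedSet w τ M → (M ∩ C).Nonempty) {f : T → ℝ}
    (hf : ∀ a ∈ C, f a = 0) : ∃ v : T → ℝ, ∀ a, f a = v a - markovOp w τ v a := by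
  classical
  -- There may be several recurrent classes inside `C`, so no single state need be accessible from
  -- everywhere. Instead `v` is prescribed to be `f = 0` on `C`; as `C` is closed, `Pv` then
  -- vanishes there and the equation holds on `C` as well.
  let L : (T → ℝ) →ₗ[ℝ] (T → ℝ) := LinearMap.id -
    LinearMap.pi fun a => if a ∈ C then 0 else (LinearMap.proj a).comp (markovOp w τ)
  have hLC : ∀ v, ∀ a ∈ C, L v a = v a := fun v a ha => by simp [L, ha]
  have hLC' : ∀ v, ∀ a ∉ C, L v a = v a - markovOp w τ v a := fun v a ha => by simp [L, ha]
  have hop : ∀ v : T → ℝ, (∀ a ∈ C, v a = 0) → ∀ a ∈ C, markovOp w τ v a = 0 := by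
    intro v hv a ha
    refine Finset.sum_eq_zero fun i _ => ?_
    rcases (hw a i).eq_or_lt with h | h
    · rw [← h, zero_mul]
    · rw [hv _ (hcl a ha i h), mul_zero]
  have hinj : Function.Injective L := by
    rw [← LinearMap.ker_eq_bot, LinearMap.ker_eq_bot']
    intro v hv
    have h0 : ∀ a ∈ C, v a = 0 := fun a ha => by rw [← hLC v a ha, hv, Pi.zero_apply]
    refine eq_zero_of_eq_markovOp hw hs hC (fun a => ?_) h0
    by_cases ha : a ∈ C
    · rw [h0 a ha, hop v h0 a ha]
    · have := hLC' v a ha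
      rw [hv, Pi.zero_apply] at this
      linarith
  obtain ⟨v, rfl⟩ := LinearMap.injective_iff_surjective.1 hinj f
  have h0 : ∀ a ∈ C, v a = 0 := fun a ha => by rw [← hLC v a ha, hf a ha]
  refine ⟨v, fun a => ?_⟩
  by_cases ha : a ∈ C
  · rw [hLC v a ha, hop v h0 a ha, sub_zero]
  · exact hLC' v a ha

end Poisson

/-! ### A strong law for centered functionals of a finite Markov chain -/

section StrongLaw

open MeasureTheory Filter

variable {S Ω : Type} {X : ℕ → Ω → S}

/-- The event that the first `n + 1` positions agree with those of `x`. -/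
def cylinderEvent (X : ℕ → Ω → S) (n : ℕ) (x : ℕ → S) : Set Ω := {ω | ∀ k ≤ n, X k ω = x k}

lemma cylinderEvent_eq_iUnion (n : ℕ) (x : ℕ → S) :
    cylinderEvent X n x = ⋃ b, cylinderEvent X (n + 1) (Function.update x (n + 1) b) := by
  ext ω
  simp only [cylinderEvent, Set.mem_ofPred_eq, Set.mem_iUnion]
  constructor
  · intro h
    refine ⟨X (n + 1) ω, fun k hk => ?_⟩
    rcases hk.eq_or_lt with rfl | hk
    · simp
    · rw [Function.update_of_ne hk.ne]
      exact h k (Nat.lt_succ_iff.1 hk)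
  · rintro ⟨b, h⟩ k hk
    rw [h k (by omega), Function.update_of_ne (by omega)]

lemma pairwise_disjoint_cylinderEvent (n : ℕ) (x : ℕ → S) :
    Pairwise (Function.onFun Disjoint
      fun b => cylinderEvent X n (Function.update x n b)) := by
  intro b c hbc
  rw [Function.onFun, Set.disjoint_left]
  intro ω hb hc
  have h1 := hb n le_rfl
  have h2 := hc n le_rfl
  rw [Function.update_self] at h1 h2
  exact hbc (h1.symm.trans h2)

/-- From `exp s ≤ 1 + s + s ^ 2` for `|s| ≤ 1`: the linear term has mean zero. -/
lemma sum_mul_exp_le [Fintype S] {p F : S → ℝ} {B t : ℝ} (hp : ∀ b, 0 ≤ p b) (hs : ∑ b, p b = 1)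
    (hF : ∀ b, |F b| ≤ B) (h0 : ∑ b, p b * F b = 0) (ht : 0 ≤ t) (htB : t * B ≤ 1) :
    ∑ b, p b * Real.exp (t * F b) ≤ Real.exp (t ^ 2 * B ^ 2) := by
  have hb : ∀ b, Real.exp (t * F b) ≤ 1 + t * F b + t ^ 2 * B ^ 2 := by
    intro b
    have h1 : |t * F b| ≤ t * B := by
      rw [abs_mul, abs_of_nonneg ht]
      exact mul_le_mul_of_nonneg_left (hF b) ht
    have h2 := le_of_abs_le (Real.abs_exp_sub_one_sub_id_le (h1.trans htB))
    have h3 : (t * F b) ^ 2 ≤ (t * B) ^ 2 := sq_le_sq' (neg_le_of_abs_le h1) (le_of_abs_le h1)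
    linarith [mul_pow t B 2]
  calc ∑ b, p b * Real.exp (t * F b) ≤ ∑ b, p b * (1 + t * F b + t ^ 2 * B ^ 2) :=
        Finset.sum_le_sum fun b _ => mul_le_mul_of_nonneg_left (hb b) (hp b)
    _ = (1 + t ^ 2 * B ^ 2) * ∑ b, p b + t * ∑ b, p b * F b := by
        rw [Finset.mul_sum, Finset.mul_sum, ← Finset.sum_add_distrib]
        exact Finset.sum_congr rfl fun b _ => by ring
    _ = t ^ 2 * B ^ 2 + 1 := by rw [hs, h0]; ring
    _ ≤ _ := Real.add_one_le_exp _

variable [MeasurableSpace S] [MeasurableSpace Ω] {ℙ : Measure Ω} {P : ℕ → Matrix S S ℝ}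

lemma IsMarkovChain.measure_cylinderEvent_succ [IsFiniteMeasure ℙ] (h : IsMarkovChain ℙ P X)
    (n : ℕ) (x : ℕ → S) :
    ℙ (cylinderEvent X (n + 1) x) =
      ℙ (cylinderEvent X n x) * ENNReal.ofReal (P n (x n) (x (n + 1))) := by
  have h1 := h.step n x
  change ℙ.real (cylinderEvent X (n + 1) x) = ℙ.real (cylinderEvent X n x) * _ at h1
  rw [← ofReal_measureReal (μ := ℙ) (s := cylinderEvent X (n + 1) x), h1,
    ENNReal.ofReal_mul measureReal_nonneg, ofReal_measureReal]

variable [MeasurableSingletonClass S]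

lemma measurableSet_cylinderEvent (hX : ∀ n, Measurable (X n)) (n : ℕ) (x : ℕ → S) :
    MeasurableSet (cylinderEvent X n x) := by
  have : cylinderEvent X n x = ⋂ k, ⋂ (_ : k ≤ n), X k ⁻¹' {x k} := by
    ext ω
    simp [cylinderEvent]
  rw [this]
  exact MeasurableSet.iInter fun k => MeasurableSet.iInter fun _ => hX k (measurableSet_singleton _)

variable [Fintype S]

lemma measurable_functional (hX : ∀ n, Measurable (X n)) (G : S → S → ℝ) (j k : ℕ) :
    Measurable fun ω => ENNReal.ofReal (G (X j ω) (X k ω)) :=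
  (Measurable.of_discrete (f := fun q : S × S => ENNReal.ofReal (G q.1 q.2))).comp
    ((hX j).prodMk (hX k))

/-- Iterated conditioning, without conditional expectations: split the cylinder by the value of `X
(m + 1)`, where the first factor is constant, and apply the induction hypothesis from time `m + 1`.
This is why `m` and `x` stay general. -/
lemma IsMarkovChain.setLIntegral_prod_le [IsFiniteMeasure ℙ] (h : IsMarkovChain ℙ P X)
    (hP : ∀ n a b, 0 ≤ P n a b) {G : ℕ → S → S → ℝ} (hG : ∀ n a b, 0 ≤ G n a b) {c : ℝ}
    (hc : ∀ n a, ∑ b, P n a b * G n a b ≤ c) (n : ℕ) :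
    ∀ (m : ℕ) (x : ℕ → S),
      ∫⁻ ω in cylinderEvent X m x, ∏ k ∈ Finset.range n,
          ENNReal.ofReal (G (m + k) (X (m + k) ω) (X (m + k + 1) ω)) ∂ℙ ≤
        ENNReal.ofReal c ^ n * ℙ (cylinderEvent X m x) := by
  induction n with
  | zero => intro m x; simp
  | succ n ih =>
    intro m x
    have hset := measurableSet_cylinderEvent h.measurable (S := S)
    rw [cylinderEvent_eq_iUnion (X := X) m x, lintegral_iUnion (fun b => hset _ _)
      (pairwise_disjoint_cylinderEvent _ _), tsum_fintype, ← cylinderEvent_eq_iUnion (X := X) m x]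
    have hterm : ∀ b, ∫⁻ ω in cylinderEvent X (m + 1) (Function.update x (m + 1) b),
        ∏ k ∈ Finset.range (n + 1),
          ENNReal.ofReal (G (m + k) (X (m + k) ω) (X (m + k + 1) ω)) ∂ℙ ≤
        ENNReal.ofReal c ^ n * ℙ (cylinderEvent X m x) *
          ENNReal.ofReal (P m (x m) b * G m (x m) b) := by
      intro b
      have hcong : ∀ ω ∈ cylinderEvent X (m + 1) (Function.update x (m + 1) b),
          ∏ k ∈ Finset.range (n + 1),
            ENNReal.ofReal (G (m + k) (X (m + k) ω) (X (m + k + 1) ω)) =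
          ENNReal.ofReal (G m (x m) b) * ∏ k ∈ Finset.range n,
            ENNReal.ofReal (G (m + 1 + k) (X (m + 1 + k) ω) (X (m + 1 + k + 1) ω)) := by
        intro ω hω
        have h1 : X m ω = x m := by
          rw [hω m (by omega), Function.update_of_ne (by omega)]
        have h2 : X (m + 1) ω = b := by rw [hω (m + 1) le_rfl, Function.update_self]
        rw [Finset.prod_range_succ', mul_comm, add_zero, h1, h2]
        congr 1
        refine Finset.prod_congr rfl fun k _ => ?_
        rw [show m + (k + 1) = m + 1 + k by omega]
      rw [setLIntegral_congr_fun (hset _ _) hcong, lintegral_const_mul _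
        (Finset.measurable_fun_prod _ fun k _ => measurable_functional h.measurable _ _ _)]
      refine (mul_le_mul_right (ih (m + 1) _) _).trans (le_of_eq ?_)
      have hcyl : cylinderEvent X m (Function.update x (m + 1) b) = cylinderEvent X m x := by
        ext ω
        refine forall₂_congr fun k hk => ?_
        rw [Function.update_of_ne (by omega)]
      rw [h.measure_cylinderEvent_succ, hcyl, Function.update_self,
        Function.update_of_ne (by omega), ENNReal.ofReal_mul (hP _ _ _)]
      ring
    calc _ ≤ ∑ b, ENNReal.ofReal c ^ n * ℙ (cylinderEvent X m x) *
          ENNReal.ofReal (P m (x m) b * G m (x m) b) := Finset.sum_le_sum fun b _ => hterm b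
      _ = ENNReal.ofReal c ^ n * ℙ (cylinderEvent X m x) *
          ENNReal.ofReal (∑ b, P m (x m) b * G m (x m) b) := by
        rw [← Finset.mul_sum, ENNReal.ofReal_sum_of_nonneg fun b _ => mul_nonneg (hP _ _ _) (hG _ _ _)]
      _ ≤ ENNReal.ofReal c ^ n * ℙ (cylinderEvent X m x) * ENNReal.ofReal c := by
        gcongr
        exact hc _ _
      _ = _ := by ring

lemma IsMarkovChain.lintegral_prod_le [IsProbabilityMeasure ℙ] (h : IsMarkovChain ℙ P X)
    (hP : ∀ n a b, 0 ≤ P n a b) {G : ℕ → S → S → ℝ} (hG : ∀ n a b, 0 ≤ G n a b) {c : ℝ}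
    (hc : ∀ n a, ∑ b, P n a b * G n a b ≤ c) (n : ℕ) :
    ∫⁻ ω, ∏ k ∈ Finset.range n, ENNReal.ofReal (G k (X k ω) (X (k + 1) ω)) ∂ℙ ≤
      ENNReal.ofReal c ^ n := by
  obtain ⟨ω₀⟩ : Nonempty Ω := nonempty_of_isProbabilityMeasure ℙ
  have huniv : (Set.univ : Set Ω) =
      ⋃ b, cylinderEvent X 0 (Function.update (fun _ => X 0 ω₀) 0 b) := by
    refine (Set.eq_univ_of_forall fun ω => Set.mem_iUnion.2 ⟨X 0 ω, fun k hk => ?_⟩).symm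
    rw [Nat.le_zero.1 hk, Function.update_self]
  have hset := measurableSet_cylinderEvent h.measurable (S := S)
  have hdis := pairwise_disjoint_cylinderEvent (X := X) 0 (fun _ => X 0 ω₀)
  rw [← setLIntegral_univ, huniv, lintegral_iUnion (fun b => hset _ _) hdis, tsum_fintype]
  calc _ ≤ ∑ b, ENNReal.ofReal c ^ n *
        ℙ (cylinderEvent X 0 (Function.update (fun _ => X 0 ω₀) 0 b)) := by
        refine Finset.sum_le_sum fun b _ => ?_
        simpa using h.setLIntegral_prod_le hP hG hc n 0 (Function.update (fun _ => X 0 ω₀) 0 b)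
    _ = ENNReal.ofReal c ^ n := by
        rw [← Finset.mul_sum, ← tsum_fintype (L := .unconditional _),
          ← measure_iUnion hdis fun b => hset _ _, ← huniv,
          measure_univ, mul_one]

/-- Chernoff's bound gives geometrically small probabilities, and Borel–Cantelli concludes. -/
lemma IsMarkovChain.ae_eventually_sum_lt [IsProbabilityMeasure ℙ] (h : IsMarkovChain ℙ P X)
    (hP : ∀ n a b, 0 ≤ P n a b) (hPs : ∀ n a, ∑ b, P n a b = 1) {F : ℕ → S → S → ℝ} {B : ℝ}
    (hB : 1 ≤ B) (hF : ∀ n a b, |F n a b| ≤ B) (h0 : ∀ n a, ∑ b, P n a b * F n a b = 0)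
    {ε : ℝ} (hε : 0 < ε) (hε1 : ε ≤ 1) :
    ∀ᵐ ω ∂ℙ, ∀ᶠ n : ℕ in atTop,
      ∑ k ∈ Finset.range n, F k (X k ω) (X (k + 1) ω) < ε * n := by
  -- This choice minimizes the exponent `t ^ 2 * B ^ 2 - t * ε`; `1 ≤ B` and `ε ≤ 1` keep `t * B ≤
  -- 1`.
  set t : ℝ := ε / (2 * B ^ 2) with ht
  have hB2 : 1 ≤ B ^ 2 := one_le_pow₀ hB
  have htpos : 0 < t := by positivity
  have htB2 : t * B ^ 2 = ε / 2 := by rw [ht]; field_simp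
  have htB : t * B ≤ 1 := by nlinarith
  set ρ : ℝ := Real.exp (t ^ 2 * B ^ 2 - t * ε) with hρ
  have hρ1 : ρ < 1 := by
    rw [hρ, Real.exp_lt_one_iff]
    nlinarith [mul_pos htpos hε]
  have hρ0 : 0 ≤ ρ := (Real.exp_pos _).le
  have hbound : ∀ n : ℕ,
      ℙ {ω | ε * n ≤ ∑ k ∈ Finset.range n, F k (X k ω) (X (k + 1) ω)} ≤
        ENNReal.ofReal (ρ ^ n) := by
    intro n
    set Z : Ω → ENNReal := fun ω => ∏ k ∈ Finset.range n,
      ENNReal.ofReal (Real.exp (t * F k (X k ω) (X (k + 1) ω))) with hZ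
    have hZm : AEMeasurable Z ℙ := (Finset.measurable_fun_prod _ fun k _ =>
      measurable_functional h.measurable (fun a b => Real.exp (t * F k a b)) _ _).aemeasurable
    have hZe : ∀ ω, Z ω =
        ENNReal.ofReal (Real.exp (t * ∑ k ∈ Finset.range n, F k (X k ω) (X (k + 1) ω))) := by
      intro ω
      rw [Finset.mul_sum, Real.exp_sum, ENNReal.ofReal_prod_of_nonneg fun k _ => (Real.exp_pos _).le]
    have hint : ∫⁻ ω, Z ω ∂ℙ ≤ ENNReal.ofReal (Real.exp (t ^ 2 * B ^ 2)) ^ n :=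
      h.lintegral_prod_le hP (G := fun k a b => Real.exp (t * F k a b))
        (fun k a b => (Real.exp_pos _).le)
        (fun k a => sum_mul_exp_le (hP k a) (hPs k a) (hF k a) (h0 k a) htpos.le htB) n
    have hmk := mul_meas_ge_le_lintegral₀ hZm (ENNReal.ofReal (Real.exp (t * (ε * n))))
    have hsub : {ω | ε * n ≤ ∑ k ∈ Finset.range n, F k (X k ω) (X (k + 1) ω)} ⊆
        {ω | ENNReal.ofReal (Real.exp (t * (ε * n))) ≤ Z ω} := by
      intro ω hω
      rw [Set.mem_ofPred_eq, hZe]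
      exact ENNReal.ofReal_le_ofReal (Real.exp_le_exp.2 (mul_le_mul_of_nonneg_left hω htpos.le))
    have hρn : ENNReal.ofReal (ρ ^ n) = ENNReal.ofReal (Real.exp (-(t * (ε * n)))) *
        ENNReal.ofReal (Real.exp (t ^ 2 * B ^ 2)) ^ n := by
      rw [← ENNReal.ofReal_pow (Real.exp_pos _).le, ← ENNReal.ofReal_mul (Real.exp_pos _).le, hρ,
        ← Real.exp_nat_mul, ← Real.exp_nat_mul, ← Real.exp_add]
      congr 2
      ring
    calc ℙ {ω | ε * n ≤ ∑ k ∈ Finset.range n, F k (X k ω) (X (k + 1) ω)}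
        ≤ ℙ {ω | ENNReal.ofReal (Real.exp (t * (ε * n))) ≤ Z ω} := measure_mono hsub
      _ = ENNReal.ofReal (Real.exp (-(t * (ε * n)))) * (ENNReal.ofReal (Real.exp (t * (ε * n))) *
          ℙ {ω | ENNReal.ofReal (Real.exp (t * (ε * n))) ≤ Z ω}) := by
        rw [← mul_assoc (ENNReal.ofReal _), ← ENNReal.ofReal_mul (Real.exp_pos _).le,
          ← Real.exp_add, neg_add_cancel,
          Real.exp_zero, ENNReal.ofReal_one, one_mul]
      _ ≤ ENNReal.ofReal (ρ ^ n) := by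
        rw [hρn]
        exact mul_le_mul_right (hmk.trans hint) _
  have hsum : ∑' n : ℕ, ℙ {ω | ε * n ≤ ∑ k ∈ Finset.range n, F k (X k ω) (X (k + 1) ω)} ≠ ⊤ :=
    ne_top_of_le_ne_top (summable_geometric_of_lt_one hρ0 hρ1).tsum_ofReal_ne_top
      (ENNReal.tsum_le_tsum hbound)
  filter_upwards [ae_eventually_notMem hsum] with ω hω
  filter_upwards [hω] with n hn
  exact not_le.1 hn

theorem IsMarkovChain.tendsto_sum_div [IsProbabilityMeasure ℙ] (h : IsMarkovChain ℙ P X)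
    (hP : ∀ n a b, 0 ≤ P n a b) (hPs : ∀ n a, ∑ b, P n a b = 1) {F : ℕ → S → S → ℝ} {B : ℝ}
    (hF : ∀ n a b, |F n a b| ≤ B) (h0 : ∀ n a, ∑ b, P n a b * F n a b = 0) :
    ∀ᵐ ω ∂ℙ, Tendsto
      (fun n : ℕ => (∑ k ∈ Finset.range n, F k (X k ω) (X (k + 1) ω)) / (n : ℝ)) atTop (nhds 0) := by
  have hF' : ∀ n a b, |F n a b| ≤ max B 1 := fun n a b => (hF n a b).trans (le_max_left _ _)
  have hε : ∀ j : ℕ, (0 : ℝ) < 1 / ((j : ℝ) + 1) := fun j => Nat.one_div_pos_of_nat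
  have hε1 : ∀ j : ℕ, 1 / ((j : ℝ) + 1) ≤ 1 := fun j =>
    div_le_one_of_le₀ (by linarith [j.cast_nonneg (α := ℝ)]) (by positivity)
  have hup := ae_all_iff.2 fun j : ℕ =>
    h.ae_eventually_sum_lt hP hPs (le_max_right B 1) hF' h0 (hε j) (hε1 j)
  have hdown := ae_all_iff.2 fun j : ℕ =>
    h.ae_eventually_sum_lt hP hPs (F := fun n a b => -F n a b) (le_max_right B 1)
      (fun n a b => by rw [abs_neg]; exact hF' n a b)
      (fun n a => by simp only [mul_neg, Finset.sum_neg_distrib, h0, neg_zero]) (hε j) (hε1 j)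
  filter_upwards [hup, hdown] with ω h1 h2
  rw [Metric.tendsto_nhds]
  intro ε hεpos
  obtain ⟨j, hj⟩ := exists_nat_one_div_lt hεpos
  filter_upwards [h1 j, h2 j, eventually_gt_atTop 0] with n hn1 hn2 hn
  have hn' : (0 : ℝ) < n := Nat.cast_pos.2 hn
  rw [Finset.sum_neg_distrib] at hn2
  rw [dist_zero_right, Real.norm_eq_abs, abs_div, abs_of_pos hn', div_lt_iff₀ hn', abs_lt]
  constructor <;> nlinarith [mul_lt_mul_of_pos_right hj hn']

end StrongLaw

/-! ### The chain of the game, and the mean profit by Poisson's equation -/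

section MeanProfit

open MeasureTheory Filter

variable {N : ℕ} {p : Fin 4 → ℝ}

/-- Indexing by the outcome of the toss, instead of by whether the status changes, lets sums over
`b` split into two terms. -/
lemma transition_eq (p : Fin 4 → ℝ) (a b : State N) :
    transition N p a b = (N : ℝ)⁻¹ *
      ((if b.1 = Function.update a.1 a.2 true then p (nbhd a.1 a.2) else 0) +
        if b.1 = Function.update a.1 a.2 false then 1 - p (nbhd a.1 a.2) else 0) := by
  have hne : Function.update a.1 a.2 true ≠ Function.update a.1 a.2 false := fun h => by
    simpa using congrFun h a.2
  have hself : ∀ c, a.1 a.2 = c → a.1 = Function.update a.1 a.2 c := fun c hc => by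
    rw [← hc, Function.update_eq_self]
  unfold transition flip
  rcases hc : a.1 a.2 with _ | _
  · rw [Bool.not_false]
    have hb : b.1 = a.1 ↔ b.1 = Function.update a.1 a.2 false := by rw [← hself _ hc]
    simp only [hb]
    by_cases h1 : b.1 = Function.update a.1 a.2 true
    · simp [h1, hne]
    · simp [h1]
  · rw [Bool.not_true]
    have hb : b.1 = a.1 ↔ b.1 = Function.update a.1 a.2 true := by rw [← hself _ hc]
    simp only [hb]
    by_cases h1 : b.1 = Function.update a.1 a.2 true
    · simp [h1, hne]
    · simp [h1]

lemma sum_transition_mul (p : Fin 4 → ℝ) (a : State N) (φ : State N → ℝ) :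
    ∑ b, transition N p a b * φ b =
      p (nbhd a.1 a.2) * ((N : ℝ)⁻¹ * ∑ j, φ (Function.update a.1 a.2 true, j)) +
        (1 - p (nbhd a.1 a.2)) * ((N : ℝ)⁻¹ * ∑ j, φ (Function.update a.1 a.2 false, j)) := by
  simp only [transition_eq, Fintype.sum_prod_type, mul_assoc, add_mul, ite_mul, zero_mul, mul_add,
    Finset.sum_add_distrib, ← Finset.mul_sum]
  rw [Finset.sum_comm, Finset.sum_comm (f := fun y j => if y = Function.update a.1 a.2 false then
    (1 - p (nbhd a.1 a.2)) * φ (y, j) else 0)]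
  simp only [Finset.sum_ite_eq', Finset.mem_univ, if_true, ← Finset.mul_sum]
  ring

lemma transition_nonneg (hp : ∀ m, p m ∈ Set.Icc (0 : ℝ) 1) (a b : State N) :
    0 ≤ transition N p a b := by
  have h0 := (hp (nbhd a.1 a.2)).1
  have h1 := sub_nonneg.2 (hp (nbhd a.1 a.2)).2
  rw [transition_eq]
  refine mul_nonneg (by positivity) (add_nonneg ?_ ?_) <;> split_ifs <;> first | assumption | rfl

lemma sum_transition (hN : N ≠ 0) (p : Fin 4 → ℝ) (a : State N) :
    ∑ b, transition N p a b = 1 := by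
  have hN' : (N : ℝ) ≠ 0 := Nat.cast_ne_zero.2 hN
  have := sum_transition_mul p a fun _ => 1
  simp only [mul_one, Finset.sum_const, Finset.card_univ, Fintype.card_fin, nsmul_eq_mul] at this
  rw [this, inv_mul_cancel₀ hN']
  ring

/-- The game of the turns whose number is `t` modulo `r + 1`, for the pattern `A^r B`. -/
noncomputable def gameAt (r : ℕ) (p : Fin 4 → ℝ) (t : Fin (r + 1)) : Fin 4 → ℝ :=
  if (t : ℕ) < r then gameA else p

/-- The number of a turn modulo `r + 1`. -/
def phase (r n : ℕ) : Fin (r + 1) := Fin.ofNat (r + 1) n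

lemma phase_zero (r : ℕ) : phase r 0 = 0 := rfl

lemma phase_succ (r n : ℕ) : phase r (n + 1) = phase r n + 1 := by
  ext
  simp [phase, Fin.val_add]

lemma pattern_one (r : ℕ) (p : Fin 4 → ℝ) (n : ℕ) :
    pattern r 1 p n = gameAt r p (phase r n) := rfl

lemma alwaysB_eq_pattern (p : Fin 4 → ℝ) : alwaysB p = pattern 0 1 p := by
  ext n : 1
  simp [alwaysB, pattern]

lemma gameAt_mem {r : ℕ} (hp : ∀ m, p m ∈ Set.Icc (0 : ℝ) 1) (t : Fin (r + 1)) (m : Fin 4) :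
    gameAt r p t m ∈ Set.Icc (0 : ℝ) 1 := by
  unfold gameAt gameA
  split_ifs
  · norm_num
  · exact hp m

/-- The probability that player `j.1` plays and obtains the outcome `j.2`. -/
noncomputable def turnWeight (r : ℕ) (p : Fin 4 → ℝ) (a : Config N × Fin (r + 1))
    (j : Fin N × Bool) : ℝ :=
  (N : ℝ)⁻¹ * if j.2 then gameAt r p a.2 (nbhd a.1 j.1) else 1 - gameAt r p a.2 (nbhd a.1 j.1)

/-- The configuration and the phase of the pattern after player `j.1` obtains the outcome `j.2`. -/
def turnMap (r : ℕ) (a : Config N × Fin (r + 1)) (j : Fin N × Bool) : Config N × Fin (r + 1) :=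
  (Function.update a.1 j.1 j.2, a.2 + 1)

/-- The expected profit in one turn. -/
noncomputable def drift (r : ℕ) (p : Fin 4 → ℝ) (a : Config N × Fin (r + 1)) : ℝ :=
  (N : ℝ)⁻¹ * ∑ i, (2 * gameAt r p a.2 (nbhd a.1 i) - 1)

lemma turnWeight_nonneg {r : ℕ} (hp : ∀ m, p m ∈ Set.Icc (0 : ℝ) 1) (a : Config N × Fin (r + 1))
    (j : Fin N × Bool) : 0 ≤ turnWeight r p a j := by
  have h := gameAt_mem hp a.2 (nbhd a.1 j.1)
  have h0 := h.1
  have h1 := sub_nonneg.2 h.2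
  refine mul_nonneg (by positivity) ?_
  split_ifs <;> assumption

lemma sum_turnWeight_mul (r : ℕ) (p : Fin 4 → ℝ) (a : Config N × Fin (r + 1))
    (φ : Fin N × Bool → ℝ) :
    ∑ j, turnWeight r p a j * φ j = (N : ℝ)⁻¹ * ∑ i, (gameAt r p a.2 (nbhd a.1 i) * φ (i, true) +
      (1 - gameAt r p a.2 (nbhd a.1 i)) * φ (i, false)) := by
  simp only [turnWeight, Fintype.sum_prod_type, Fintype.sum_bool, mul_assoc, ← Finset.mul_sum,
    if_true, Bool.false_eq_true, if_false]

lemma sum_turnWeight (hN : N ≠ 0) (r : ℕ) (p : Fin 4 → ℝ) (a : Config N × Fin (r + 1)) :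
    ∑ j, turnWeight r p a j = 1 := by
  have h := sum_turnWeight_mul r p a fun _ => 1
  simpa [hN] using h

theorem hasMeanProfit_of_poisson (hN : N ≠ 0) (hp : ∀ m, p m ∈ Set.Icc (0 : ℝ) 1) {r : ℕ} {μ : ℝ}
    {v : Config N × Fin (r + 1) → ℝ}
    (hv : ∀ a, drift r p a = μ + v a - markovOp (turnWeight r p) (turnMap r) v a) :
    HasMeanProfit N (pattern r 1 p) μ := by
  intro Ω _ ℙ _ X hX
  have hN' : (N : ℝ) ≠ 0 := Nat.cast_ne_zero.2 hN
  -- The solution `v` does not see the next player. Here `g` is the expected profit of the turn plus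
  -- `v` afterwards, given the player; averaging over him returns `μ + v`.
  let g : Fin (r + 1) → State N → ℝ := fun t a =>
    2 * gameAt r p t (nbhd a.1 a.2) - 1 +
      (gameAt r p t (nbhd a.1 a.2) * v (Function.update a.1 a.2 true, t + 1) +
        (1 - gameAt r p t (nbhd a.1 a.2)) * v (Function.update a.1 a.2 false, t + 1))
  have hg : ∀ t x, (N : ℝ)⁻¹ * ∑ j, g t (x, j) = μ + v (x, t) := by
    intro t x
    have h1 := hv (x, t)
    rw [markovOp_apply, sum_turnWeight_mul] at h1
    simp only [g, Finset.sum_add_distrib, mul_add, drift, turnMap] at h1 ⊢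
    linarith
  let F : ℕ → State N → State N → ℝ := fun n a b =>
    payoff a b - μ + g (phase r (n + 1)) b - g (phase r n) a
  have hF0 : ∀ n a, ∑ b, transition N (pattern r 1 p n) a b * F n a b = 0 := by
    intro n a
    rw [sum_transition_mul]
    simp only [F, Finset.sum_add_distrib, Finset.sum_sub_distrib, mul_add, mul_sub, hg, payoff,
      Function.update_self, if_true, Finset.sum_const, Finset.card_univ, Fintype.card_fin,
      nsmul_eq_mul, Bool.false_eq_true, if_false]
    have hgn : g (phase r n) a = 2 * gameAt r p (phase r n) (nbhd a.1 a.2) - 1 +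
      (gameAt r p (phase r n) (nbhd a.1 a.2) * v (Function.update a.1 a.2 true, phase r (n + 1)) +
        (1 - gameAt r p (phase r n) (nbhd a.1 a.2)) *
          v (Function.update a.1 a.2 false, phase r (n + 1))) := by
      simp only [g, phase_succ]
    simp only [inv_mul_cancel_left₀ hN', hgn, pattern_one]
    ring
  obtain ⟨C, hC⟩ : ∃ C, ∀ t a, |g t a| ≤ C := by
    obtain ⟨C, hC⟩ := Set.Finite.bddAbove (Set.finite_range fun q : Fin (r + 1) × State N =>
      |g q.1 q.2|)
    exact ⟨C, fun t a => hC ⟨(t, a), rfl⟩⟩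
  have hFB : ∀ n a b, |F n a b| ≤ 1 + |μ| + C + C := by
    intro n a b
    have hpay : |payoff a b| ≤ 1 := by
      unfold payoff
      split_ifs <;> simp
    refine (abs_sub _ _).trans (add_le_add ((abs_add_le _ _).trans (add_le_add ?_ (hC _ _))) (hC _ _))
    exact (abs_sub _ _).trans (add_le_add hpay le_rfl)
  have hmem : ∀ n m, pattern r 1 p n m ∈ Set.Icc (0 : ℝ) 1 := fun n m => by
    rw [pattern_one]
    exact gameAt_mem hp _ m
  filter_upwards [hX.tendsto_sum_div (fun n => transition_nonneg (hmem n))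
    (fun n => sum_transition hN _) hFB hF0] with ω hω
  have hbd : Tendsto (fun n : ℕ => (g 0 (X 0 ω) - g (phase r n) (X n ω)) / (n : ℝ)) atTop (nhds 0) := by
    refine squeeze_zero_norm (fun n => ?_) (tendsto_const_div_atTop_nhds_zero_nat (C + C))
    rw [norm_div, Real.norm_eq_abs, Real.norm_natCast]
    gcongr
    exact (abs_sub _ _).trans (add_le_add (hC _ _) (hC _ _))
  have hlim := (hω.add hbd).add_const μ
  rw [zero_add, zero_add] at hlim
  refine hlim.congr' ?_
  filter_upwards [eventually_gt_atTop 0] with n hn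
  have hn' : (n : ℝ) ≠ 0 := Nat.cast_ne_zero.2 hn.ne'
  have htel : ∑ k ∈ Finset.range n, F k (X k ω) (X (k + 1) ω) =
      ∑ k ∈ Finset.range n, payoff (X k ω) (X (k + 1) ω) - n * μ +
        (g (phase r n) (X n ω) - g 0 (X 0 ω)) := by
    have := Finset.sum_range_sub (fun k => g (phase r k) (X k ω)) n
    rw [phase_zero] at this
    rw [← this]
    simp only [F, add_sub_assoc, Finset.sum_add_distrib, Finset.sum_sub_distrib, Finset.sum_const,
      Finset.card_range, nsmul_eq_mul]
  rw [htel]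
  field_simp
  ring

/-! ### Existence of the chain, and uniqueness of the mean profit -/

/-- Compose independent random maps of `S` whose values at `a` follow row `a` of the matrix.
Existence is needed because `HasMeanProfit` quantifies over all chains and could otherwise hold
vacuously for every `μ`. -/
lemma exists_isMarkovChain {S : Type} [Fintype S] [Nonempty S] [MeasurableSpace S]
    [MeasurableSingletonClass S] (P : ℕ → Matrix S S ℝ) (hP : ∀ n a b, 0 ≤ P n a b)
    (hPs : ∀ n a, ∑ b, P n a b = 1) :
    ∃ (Ω : Type) (_ : MeasurableSpace Ω) (ℙ : Measure Ω) (_ : IsProbabilityMeasure ℙ)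
      (X : ℕ → Ω → S), IsMarkovChain ℙ P X := by
  classical
  let row : ℕ → S → PMF S := fun n a => PMF.ofFintype (fun b => ENNReal.ofReal (P n a b)) (by
    rw [← ENNReal.ofReal_sum_of_nonneg fun b _ => hP n a b, hPs, ENNReal.ofReal_one])
  let ν : ℕ → Measure (S → S) := fun n => Measure.pi fun a => (row n a).toMeasure
  let ℙ : Measure (ℕ → S → S) := Measure.infinitePi ν
  obtain ⟨s₀⟩ := ‹Nonempty S›
  let X : ℕ → (ℕ → S → S) → S := fun n ω => Nat.rec s₀ (fun k s => ω k s) n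
  have hX0 : ∀ ω, X 0 ω = s₀ := fun ω => rfl
  have hXs : ∀ n ω, X (n + 1) ω = ω n (X n ω) := fun n ω => rfl
  have hν : ∀ n a b, ν n {φ | φ a = b} = ENNReal.ofReal (P n a b) := by
    intro n a b
    have : {φ : S → S | φ a = b} = Function.eval a ⁻¹' ({b} : Set S) := rfl
    rw [this, ← Measure.map_apply (measurable_pi_apply a) (measurableSet_singleton b),
      (measurePreserving_eval (fun a => (row n a).toMeasure) a).map_eq,
      PMF.toMeasure_apply_singleton _ _ (measurableSet_singleton b), PMF.ofFintype_apply]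
  have hev : ∀ a b, MeasurableSet {φ : S → S | φ a = b} := fun a b =>
    (measurable_pi_apply (X := fun _ : S => S) a) (measurableSet_singleton b)
  have hset : ∀ n (x : ℕ → S), x 0 = s₀ → {ω | ∀ k ≤ n, X k ω = x k} =
      Set.pi (Finset.range n : Set ℕ) fun k => {φ | φ (x k) = x (k + 1)} := by
    intro n x hx
    ext ω
    simp only [Set.mem_ofPred_eq, Set.mem_pi, Finset.coe_range, Set.mem_Iio]
    constructor
    · intro h k hk
      rw [← h k hk.le]
      exact h (k + 1) hk
    · intro h k
      induction k with
      | zero => exact fun _ => hx.symm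
      | succ k ih =>
        intro hk
        rw [hXs, ih (by omega), h k hk]
  refine ⟨ℕ → S → S, inferInstance, ℙ, inferInstance, X, ⟨fun n => ?_, fun n x => ?_⟩⟩
  · induction n with
    | zero => exact measurable_const
    | succ n ih =>
      have : Measurable fun q : (S → S) × S => q.1 q.2 := Measurable.of_discrete
      exact this.comp ((measurable_pi_apply n).prodMk ih)
  · by_cases hx : x 0 = s₀
    · rw [hset _ _ hx, hset _ _ hx, measureReal_def, measureReal_def,
        Measure.infinitePi_pi _ fun k _ => hev _ _, Measure.infinitePi_pi _ fun k _ => hev _ _,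
        Finset.prod_range_succ, ENNReal.toReal_mul, hν, ENNReal.toReal_ofReal (hP _ _ _)]
    · have : ∀ m, {ω | ∀ k ≤ m, X k ω = x k} = ∅ := fun m =>
        Set.eq_empty_of_forall_notMem fun ω hω => hx (hω 0 m.zero_le).symm
      rw [this, this, measureReal_empty, zero_mul]

lemma HasMeanProfit.unique (hN : N ≠ 0) {game : ℕ → Fin 4 → ℝ}
    (hgame : ∀ n m, game n m ∈ Set.Icc (0 : ℝ) 1) {μ μ' : ℝ} (h : HasMeanProfit N game μ)
    (h' : HasMeanProfit N game μ') : μ = μ' := by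
  have : NeZero N := ⟨hN⟩
  obtain ⟨Ω, _, ℙ, _, X, hX⟩ := exists_isMarkovChain (fun n => transition N (game n))
    (fun n => transition_nonneg (hgame n)) (fun n => sum_transition hN _)
  obtain ⟨ω, h1, h2⟩ := ((h Ω ℙ X hX).and (h' Ω ℙ X hX)).exists
  exact tendsto_nhds_unique h1 h2

end MeanProfit

/-! ### Comparison of the drift with the number of players with discordant neighbors -/

section Drift

variable {N : ℕ}

/-- The fraction of the players whose two neighbors have different statuses. -/
noncomputable def discord (x : Config N) : ℝ :=
  (N : ℝ)⁻¹ * ∑ i, if x ((finRotate N).symm i) = x (finRotate N i) then 0 else 1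

/-- One half minus the fraction of winners. -/
noncomputable def loserExcess (x : Config N) : ℝ :=
  1 / 2 - (N : ℝ)⁻¹ * ∑ i, if x i then 1 else 0

lemma discord_nonneg (x : Config N) : 0 ≤ discord x :=
  mul_nonneg (by positivity) (Finset.sum_nonneg fun i _ => by split_ifs <;> norm_num)

lemma discord_pos (hN : N ≠ 0) {x : Config N} (i : Fin N)
    (h : x ((finRotate N).symm i) ≠ x (finRotate N i)) : 0 < discord x := by
  have hN' : 0 < (N : ℝ) := Nat.cast_pos.2 (Nat.pos_of_ne_zero hN)
  refine mul_pos (inv_pos.2 hN') (Finset.sum_pos' (fun i _ => by split_ifs <;> norm_num)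
    ⟨i, Finset.mem_univ i, ?_⟩)
  rw [if_neg h]
  exact one_pos

lemma param_nbhd (p₁ : ℝ) (x : Config N) (i : Fin N) :
    (![1, p₁, p₁, 0] : Fin 4 → ℝ) (nbhd x i) =
      if x ((finRotate N).symm i) = x (finRotate N i) then
        (if x (finRotate N i) then 0 else 1) else p₁ := by
  unfold nbhd
  cases x ((finRotate N).symm i) <;> cases x (finRotate N i) <;> rfl

/-- With `p₀ = 1` and `p₃ = 0` the expected profit is affine in the neighbors' statuses, except for
a bonus when they disagree. -/
lemma two_mul_param_nbhd_sub_one (p₁ : ℝ) (x : Config N) (i : Fin N) :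
    2 * (![1, p₁, p₁, 0] : Fin 4 → ℝ) (nbhd x i) - 1 =
      1 - (if x ((finRotate N).symm i) then 1 else 0) - (if x (finRotate N i) then 1 else 0) +
        (2 * p₁ - 1) * (if x ((finRotate N).symm i) = x (finRotate N i) then 0 else 1) := by
  rw [param_nbhd]
  cases x ((finRotate N).symm i) <;> cases x (finRotate N i) <;> norm_num

lemma drift_of_lt {r : ℕ} (p : Fin 4 → ℝ) {a : Config N × Fin (r + 1)} (h : (a.2 : ℕ) < r) :
    drift r p a = 0 := by
  simp [drift, gameAt, h, gameA]

lemma drift_of_eq_last (hN : N ≠ 0) {r : ℕ} (p₁ : ℝ) {a : Config N × Fin (r + 1)}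
    (h : a.2 = Fin.last r) :
    drift r ![1, p₁, p₁, 0] a = 2 * loserExcess a.1 + (2 * p₁ - 1) * discord a.1 := by
  have hN' : (N : ℝ) ≠ 0 := Nat.cast_ne_zero.2 hN
  have h1 := Equiv.sum_comp (finRotate N) fun i => if a.1 i then (1 : ℝ) else 0
  have h2 := Equiv.sum_comp (finRotate N).symm fun i => if a.1 i then (1 : ℝ) else 0
  have hg : gameAt r ![1, p₁, p₁, 0] a.2 = ![1, p₁, p₁, 0] := by simp [gameAt, h]
  simp only [drift, loserExcess, discord, hg, two_mul_param_nbhd_sub_one, Finset.sum_add_distrib,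
    Finset.sum_sub_distrib, h1, h2, ← Finset.mul_sum, Finset.sum_const, Finset.card_univ,
    Fintype.card_fin, nsmul_eq_mul]
  field_simp
  ring

lemma loserExcess_update (x : Config N) (i : Fin N) (c : Bool) :
    loserExcess (Function.update x i c) =
      loserExcess x + (N : ℝ)⁻¹ * ((if x i then 1 else 0) - if c then 1 else 0) := by
  have hsum : ∀ y : Config N, ∑ j, (if y j then (1 : ℝ) else 0) =
      (if y i then 1 else 0) + ∑ j ∈ Finset.univ.erase i, if y j then (1 : ℝ) else 0 := fun y =>
    (Finset.add_sum_erase _ _ (Finset.mem_univ i)).symm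
  have hrest : ∑ j ∈ Finset.univ.erase i, (if Function.update x i c j then (1 : ℝ) else 0) =
      ∑ j ∈ Finset.univ.erase i, if x j then (1 : ℝ) else 0 :=
    Finset.sum_congr rfl fun j hj => by rw [Function.update_of_ne (Finset.ne_of_mem_erase hj)]
  rw [loserExcess, loserExcess, hsum, hsum x, hrest, Function.update_self]
  ring

/-- The turn replaces a uniformly chosen status by the outcome of the toss, whose mean is determined
by the drift. -/
lemma markovOp_loserExcess (hN : N ≠ 0) {r : ℕ} (p : Fin 4 → ℝ) (e : Fin (r + 1) → ℝ)
    (a : Config N × Fin (r + 1)) :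
    markovOp (turnWeight r p) (turnMap r) (fun b => e b.2 * loserExcess b.1) a =
      e (a.2 + 1) * (loserExcess a.1 - (N : ℝ)⁻¹ * (loserExcess a.1 + drift r p a / 2)) := by
  have hN' : (N : ℝ) ≠ 0 := Nat.cast_ne_zero.2 hN
  have hterm : ∀ i, gameAt r p a.2 (nbhd a.1 i) *
        (e (a.2 + 1) * loserExcess (Function.update a.1 i true)) +
      (1 - gameAt r p a.2 (nbhd a.1 i)) *
        (e (a.2 + 1) * loserExcess (Function.update a.1 i false)) =
      e (a.2 + 1) * (loserExcess a.1 + (N : ℝ)⁻¹ * ((if a.1 i then 1 else 0) -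
        (2 * gameAt r p a.2 (nbhd a.1 i) - 1) / 2 - 1 / 2)) := by
    intro i
    rw [loserExcess_update, loserExcess_update, if_pos rfl, if_neg Bool.false_ne_true]
    ring
  rw [markovOp_apply, sum_turnWeight_mul]
  simp only [turnMap, hterm, ← Finset.mul_sum, Finset.sum_add_distrib, Finset.sum_sub_distrib,
    Finset.sum_const, Finset.card_univ, Fintype.card_fin, nsmul_eq_mul, ← Finset.sum_div]
  have hd : ∑ i, 2 * gameAt r p a.2 (nbhd a.1 i) = N * drift r p a + N := by
    rw [drift, mul_inv_cancel_left₀ hN']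
    simp [Finset.sum_sub_distrib]
  have hx : ∑ i, (if a.1 i then (1 : ℝ) else 0) = N * (1 / 2 - loserExcess a.1) := by
    rw [loserExcess, sub_sub_cancel, mul_inv_cancel_left₀ hN']
  rw [Finset.mul_sum, hd, hx]
  field_simp
  ring

/-- Up to a coboundary, the drift is a positive multiple of the discord at the turns of game `B`. -/
lemma exists_drift_eq (hN : 2 ≤ N) {p₁ : ℝ} (hp : 1 / 2 < p₁) (r : ℕ) :
    ∃ (κ : ℝ) (w : Config N × Fin (r + 1) → ℝ), 0 < κ ∧
      ∀ a, drift r ![1, p₁, p₁, 0] a = (if a.2 = Fin.last r then κ * discord a.1 else 0) + w a -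
        markovOp (turnWeight r ![1, p₁, p₁, 0]) (turnMap r) w a := by
  have hN0 : N ≠ 0 := by omega
  have hN2 : (2 : ℝ) ≤ N := by exact_mod_cast hN
  have hN' : (N : ℝ) ≠ 0 := by positivity
  set q : ℝ := 1 - (N : ℝ)⁻¹ with hq
  have hi : 0 < (N : ℝ)⁻¹ := by positivity
  have hi2 : 2 * (N : ℝ)⁻¹ ≤ 1 := by
    rw [← div_eq_mul_inv]
    exact div_le_one_of_le₀ hN2 (by positivity)
  have hq0 : 0 < q := by linarith
  have hqr : q ^ r ≤ 1 := pow_le_one₀ hq0.le (by linarith)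
  have hqr0 : 0 < q ^ r := pow_pos hq0 r
  set d : ℝ := 1 - q ^ r * (1 - 2 * (N : ℝ)⁻¹) with hd
  have hdpos : (N : ℝ)⁻¹ * q ^ r < d := by nlinarith
  have hd0 : 0 < d := lt_trans (by positivity) hdpos
  have hκ : 0 < 1 - (N : ℝ)⁻¹ * q ^ r / d := by
    rw [sub_pos, div_lt_one hd0]
    exact hdpos
  -- A turn of `A` multiplies the mean loser excess by `q`, which forces `e` to be geometric in the
  -- phase. At the turn of `B` the factor is `1 - 2 / N`, and matching the coefficient of the loser
  -- excess gives `2 / d`. The discord lost in this matching accounts for the second factor of `κ`.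
  let e : Fin (r + 1) → ℝ := fun t => 2 / d * q ^ (r - (t : ℕ))
  refine ⟨(2 * p₁ - 1) * (1 - (N : ℝ)⁻¹ * q ^ r / d), fun b => e b.2 * loserExcess b.1,
    mul_pos (by linarith) hκ, fun a => ?_⟩
  rw [markovOp_loserExcess hN0]
  simp only [e]
  rcases lt_or_eq_of_le (Fin.le_last a.2) with h | h
  · have hlt : (a.2 : ℕ) < r := h
    rw [drift_of_lt _ hlt, if_neg h.ne, Fin.val_add_one_of_lt h,
      show r - (a.2 : ℕ) = r - (a.2 + 1) + 1 by omega, pow_succ]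
    ring
  · rw [drift_of_eq_last hN0 p₁ h, if_pos h, h, Fin.last_add_one, Fin.val_zero, Fin.val_last,
      Nat.sub_zero, Nat.sub_self, pow_zero]
    field_simp
    rw [hd, hq]
    field_simp
    ring

end Drift

/-! ### Accessibility -/

section Accessibility

variable {N r : ℕ} {p₁ : ℝ}

/-- The alternating configuration with status `b` of the first player. -/
def alternating (N : ℕ) (b : Bool) : Config N := fun k => b ^^ Nat.bodd k

lemma finRotate_val_of_lt {i : Fin N} (h : (i : ℕ) + 1 < N) :
    (finRotate N i : ℕ) = i + 1 := by
  obtain ⟨n, rfl⟩ : ∃ n, N = n + 1 := ⟨N - 1, by omega⟩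
  rw [finRotate_apply, Fin.val_add_one_of_lt]
  exact Fin.lt_def.2 (by simp; omega)

lemma finRotate_symm_eq {i j : Fin N} (h : (i : ℕ) + 1 = j) : (finRotate N).symm j = i := by
  rw [Equiv.symm_apply_eq]
  ext
  rw [finRotate_val_of_lt (h ▸ j.2), h]

lemma alternating_finRotate (b : Bool) {i : Fin N} (h : (i : ℕ) + 1 < N) :
    alternating N b (finRotate N i) = !alternating N b i := by
  rw [alternating, finRotate_val_of_lt h, Nat.bodd_succ, alternating, Bool.xor_not]

lemma finRotate_last_eq (hN : 0 < N) : finRotate N ⟨N - 1, by omega⟩ = ⟨0, hN⟩ := by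
  obtain ⟨n, rfl⟩ : ∃ n, N = n + 1 := ⟨N - 1, by omega⟩
  exact finRotate_last

lemma finRotate_symm_zero (hN : 0 < N) : (finRotate N).symm ⟨0, hN⟩ = ⟨N - 1, by omega⟩ := by
  rw [Equiv.symm_apply_eq, finRotate_last_eq hN]

/-- A set of configurations in which every player may take the status opposite to his left
neighbor's contains an alternating configuration. -/
lemma alternating_mem (hN : 0 < N) {U : Set (Config N)}
    (hU : ∀ x ∈ U, ∀ k, Function.update x k (!x ((finRotate N).symm k)) ∈ U) {x : Config N}
    (hx : x ∈ U) : alternating N (x ⟨0, hN⟩) ∈ U := by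
  -- Sweep around the circle: players `0, …, m` already alternate, and player `m + 1` opposes player
  -- `m`.
  have key : ∀ m < N,
      (fun k : Fin N => if (k : ℕ) ≤ m then alternating N (x ⟨0, hN⟩) k else x k) ∈ U := by
    intro m
    induction m with
    | zero =>
      intro _
      convert hx using 1
      ext k
      rcases Nat.eq_zero_or_pos (k : ℕ) with h | h
      · obtain rfl : k = ⟨0, hN⟩ := Fin.ext h
        simp [alternating]
      · rw [if_neg (by omega)]
    | succ m ih =>
      intro hm
      convert hU _ (ih (by omega)) ⟨m + 1, hm⟩ using 1
      ext k
      rw [finRotate_symm_eq (i := ⟨m, by omega⟩) rfl]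
      rcases eq_or_ne k ⟨m + 1, hm⟩ with rfl | hk
      · simp [alternating]
      · have hk' : (k : ℕ) ≠ m + 1 := fun h => hk (Fin.ext h)
        rw [Function.update_of_ne hk]
        by_cases h : (k : ℕ) ≤ m
        · rw [if_pos h, if_pos (by omega)]
        · rw [if_neg h, if_neg (by omega)]
  convert key (N - 1) (by omega) using 1
  ext k
  rw [if_pos (by omega)]

variable {M : Set (Config N × Fin (r + 1))} {p : Fin 4 → ℝ}

lemma update_mem_of_lt (hM : IsClosedSet (turnWeight r p) (turnMap r) M)
    {a : Config N × Fin (r + 1)} (ha : a ∈ M) (hlt : (a.2 : ℕ) < r) (i : Fin N) (c : Bool) :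
    (Function.update a.1 i c, a.2 + 1) ∈ M := by
  have hN : 0 < (N : ℝ) := Nat.cast_pos.2 (i.pos)
  refine hM a ha (i, c) (mul_pos (inv_pos.2 hN) ?_)
  cases c <;> norm_num [gameAt, hlt, gameA]

/-- A fair toss may leave the status as it was, so the turns of `A` can pass without effect. -/
lemma mem_last (hN : 0 < N) (hM : IsClosedSet (turnWeight r p) (turnMap r) M) {x : Config N}
    {t : Fin (r + 1)} (h : (x, t) ∈ M) : (x, Fin.last r) ∈ M := by
  induction t using Fin.reverseInduction with
  | last => exact h
  | cast t ih =>
    have := update_mem_of_lt hM h t.2 ⟨0, hN⟩ (x ⟨0, hN⟩)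
    rw [Function.update_eq_self] at this
    refine ih ?_
    rwa [← Fin.coeSucc_eq_succ]

/-- If the neighbors agree, `p₀ = 1` or `p₃ = 0` forces this outcome; if they disagree, `0 < p₁ < 1`
allows it. -/
lemma oppose_mem (hp : p₁ ∈ Set.Ioo (1 / 2 : ℝ) 1)
    (hM : IsClosedSet (turnWeight r ![1, p₁, p₁, 0]) (turnMap r) M) {x : Config N}
    (hx : (x, Fin.last r) ∈ M) (k : Fin N) :
    (Function.update x k (!x ((finRotate N).symm k)), (0 : Fin (r + 1))) ∈ M := by
  have hN : 0 < (N : ℝ) := Nat.cast_pos.2 (k.pos)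
  have := hM _ hx (k, !x ((finRotate N).symm k)) (mul_pos (inv_pos.2 hN) ?_)
  · rwa [turnMap, Fin.last_add_one] at this
  · have h0 : 0 < p₁ := by linarith [hp.1]
    have h1 : 0 < 1 - p₁ := by linarith [hp.2]
    simp only [gameAt, Fin.val_last, lt_irrefl, if_false, param_nbhd]
    cases x ((finRotate N).symm k) <;> cases x (finRotate N k) <;> simp_all

lemma exists_alternating_mem (hN : 0 < N) (hp : p₁ ∈ Set.Ioo (1 / 2 : ℝ) 1) (hne : M.Nonempty)
    (hM : IsClosedSet (turnWeight r ![1, p₁, p₁, 0]) (turnMap r) M) :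
    ∃ b, (alternating N b, Fin.last r) ∈ M := by
  obtain ⟨⟨x, t⟩, hx⟩ := hne
  exact ⟨_, alternating_mem (U := {x | (x, Fin.last r) ∈ M}) hN
    (fun y hy k => mem_last hN hM (oppose_mem hp hM hy k)) (mem_last hN hM hx)⟩

lemma alternating_false_mem_of_odd (hN : Odd N) (hp : p₁ ∈ Set.Ioo (1 / 2 : ℝ) 1)
    (hne : M.Nonempty) (hM : IsClosedSet (turnWeight r ![1, p₁, p₁, 0]) (turnMap r) M) :
    (alternating N false, Fin.last r) ∈ M := by
  have hN0 : 0 < N := hN.pos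
  obtain ⟨b, hb⟩ := exists_alternating_mem hN0 hp hne hM
  cases b with
  | false => exact hb
  | true =>
    -- For odd `N` the last player is also a winner here, so player `0`, opposing him, becomes a
    -- loser; a second sweep then starts from `false`.
    have hb' := mem_last hN0 hM (oppose_mem hp hM hb ⟨0, hN0⟩)
    have hpar : Nat.bodd (N - 1) = false := by
      obtain ⟨m, rfl⟩ := hN
      simp [Nat.bodd_mul, show Nat.bodd 2 = false from rfl]
    have := alternating_mem (U := {x | (x, Fin.last r) ∈ M}) hN0
      (fun y hy k => mem_last hN0 hM (oppose_mem hp hM hy k)) hb'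
    rw [Function.update_self, finRotate_symm_zero] at this
    simpa [alternating, hpar] using this

lemma update_oppose_mem (hr : 1 ≤ r) (hp : p₁ ∈ Set.Ioo (1 / 2 : ℝ) 1)
    (hM : IsClosedSet (turnWeight r ![1, p₁, p₁, 0]) (turnMap r) M) {x : Config N}
    (hx : (x, Fin.last r) ∈ M) (k j : Fin N) (c : Bool) :
    (Function.update (Function.update x k (!x ((finRotate N).symm k))) j c, Fin.last r) ∈ M :=
  mem_last k.pos hM (update_mem_of_lt hM (oppose_mem hp hM hx k) hr j c)

/-- A turn of `A` can make player `0` a loser before a new sweep, whatever the parity of `N`. -/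
lemma alternating_false_mem (hN : 0 < N) (hr : 1 ≤ r) (hp : p₁ ∈ Set.Ioo (1 / 2 : ℝ) 1)
    (hne : M.Nonempty) (hM : IsClosedSet (turnWeight r ![1, p₁, p₁, 0]) (turnMap r) M) :
    (alternating N false, Fin.last r) ∈ M := by
  obtain ⟨b, hb⟩ := exists_alternating_mem hN hp hne hM
  have := alternating_mem (U := {x | (x, Fin.last r) ∈ M}) hN
    (fun y hy k => mem_last hN hM (oppose_mem hp hM hy k))
    (update_oppose_mem hr hp hM hb ⟨0, hN⟩ ⟨0, hN⟩ false)
  rwa [Function.update_self] at this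

lemma discord_alternating_pos (hN : Odd N) (hN1 : 1 < N) : 0 < discord (alternating N false) := by
  refine discord_pos (by omega) ⟨0, by omega⟩ ?_
  have hpar : Nat.bodd (N - 1) = false := by
    obtain ⟨m, rfl⟩ := hN
    simp [show Nat.bodd 2 = false from rfl]
  rw [finRotate_symm_zero, alternating_finRotate _ (by simpa using hN1)]
  simp [alternating, hpar]

/-- In the alternating configuration player `1` may keep his status at the turn of `B`; a turn of
`A` then makes player `0` a winner, while player `2` is a loser. -/
lemma exists_mem_discord_pos (hN : 3 ≤ N) (hr : 1 ≤ r) (hp : p₁ ∈ Set.Ioo (1 / 2 : ℝ) 1)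
    (hne : M.Nonempty) (hM : IsClosedSet (turnWeight r ![1, p₁, p₁, 0]) (turnMap r) M) :
    ∃ x, (x, Fin.last r) ∈ M ∧ 0 < discord x := by
  refine ⟨_, update_oppose_mem hr hp hM (alternating_false_mem (by omega) hr hp hne hM)
    ⟨1, by omega⟩ ⟨0, by omega⟩ true, discord_pos (by omega) ⟨1, by omega⟩ ?_⟩
  have h2 : finRotate N ⟨1, by omega⟩ = ⟨2, by omega⟩ :=
    Fin.ext (finRotate_val_of_lt (show 1 + 1 < N by omega))
  rw [finRotate_symm_eq (i := ⟨0, by omega⟩) rfl, h2, Function.update_self]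
  simp [alternating]

/-- The set of the states with an alternating configuration. -/
def alternatingSet (N r : ℕ) : Set (Config N × Fin (r + 1)) :=
  {a | ∀ i, a.1 (finRotate N i) = !a.1 i}

lemma alternating_mem_alternatingSet (hN : Even N) (b : Bool) (t : Fin (r + 1)) :
    (alternating N b, t) ∈ alternatingSet N r := by
  intro i
  rcases Nat.lt_or_ge ((i : ℕ) + 1) N with h | h
  · exact alternating_finRotate b h
  · have hN0 : 0 < N := i.pos
    have hi : i = ⟨N - 1, by omega⟩ := Fin.ext (by simp; omega)
    have hpar : Nat.bodd (N - 1) = true := by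
      clear hi
      obtain ⟨m, rfl⟩ := hN
      obtain ⟨l, rfl⟩ : ∃ l, m = l + 1 := ⟨m - 1, by omega⟩
      rw [show l + 1 + (l + 1) - 1 = l + l + 1 by omega]
      simp
    rw [hi, finRotate_last_eq hN0]
    simp [alternating, hpar]

lemma eq_not_of_mem_alternatingSet {a : Config N × Fin (r + 1)} (ha : a ∈ alternatingSet N r)
    (i : Fin N) : a.1 ((finRotate N).symm i) = !a.1 i := by
  have := ha ((finRotate N).symm i)
  rw [Equiv.apply_symm_apply] at this
  rw [this, Bool.not_not]

lemma discord_eq_zero {a : Config N × Fin (r + 1)} (ha : a ∈ alternatingSet N r) :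
    discord a.1 = 0 := by
  rw [discord, Finset.sum_eq_zero, mul_zero]
  intro i _
  rw [if_pos]
  rw [eq_not_of_mem_alternatingSet ha, ha i]

/-- Both neighbors of each player have the status opposite to his, so the deterministic coins `p₀ =
1` and `p₃ = 0` reproduce his status: the configuration is frozen. -/
lemma isClosedSet_alternatingSet (p₁ : ℝ) :
    IsClosedSet (turnWeight 0 ![1, p₁, p₁, 0]) (turnMap 0) (alternatingSet N 0) := by
  intro a ha j hj
  have hc : j.2 = a.1 j.1 := by
    have hg : gameAt 0 ![1, p₁, p₁, 0] a.2 = ![1, p₁, p₁, 0] := by simp [gameAt]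
    rw [turnWeight, hg, param_nbhd, eq_not_of_mem_alternatingSet ha, ha j.1] at hj
    revert hj
    cases a.1 j.1 <;> cases j.2 <;> simp
  intro i
  rw [turnMap, hc, Function.update_eq_self]
  exact ha i

end Accessibility

/-! ### The mean profits -/

section Main

variable {N : ℕ} {p₁ : ℝ}

lemma param_mem_Icc (hp : p₁ ∈ Set.Ioo (1 / 2 : ℝ) 1) (m : Fin 4) :
    (![1, p₁, p₁, 0] : Fin 4 → ℝ) m ∈ Set.Icc (0 : ℝ) 1 := by
  have h0 : 0 ≤ p₁ := by linarith [hp.1]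
  have h1 : p₁ ≤ 1 := hp.2.le
  fin_cases m <;> simp [h0, h1]

/-- It suffices to solve Poisson's equation for the discord at the turns of game `B`. -/
lemma exists_hasMeanProfit_of_poisson (hN : 3 ≤ N) (hp : p₁ ∈ Set.Ioo (1 / 2 : ℝ) 1) (r : ℕ) :
    ∃ κ : ℝ, 0 < κ ∧ ∀ (μ : ℝ) (v : Config N × Fin (r + 1) → ℝ),
      (∀ a, (if a.2 = Fin.last r then κ * discord a.1 else 0) =
        μ + v a - markovOp (turnWeight r ![1, p₁, p₁, 0]) (turnMap r) v a) →
      HasMeanProfit N (pattern r 1 ![1, p₁, p₁, 0]) μ := by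
  obtain ⟨κ, w, hκ, hw⟩ := exists_drift_eq (N := N) (by omega) hp.1 r
  refine ⟨κ, hκ, fun μ v hv => hasMeanProfit_of_poisson (v := v + w) (by omega) (param_mem_Icc hp)
    fun a => ?_⟩
  rw [hw, hv, map_add, Pi.add_apply, Pi.add_apply]
  ring

lemma exists_pos_hasMeanProfit_pattern (hN : 3 ≤ N) (hp : p₁ ∈ Set.Ioo (1 / 2 : ℝ) 1) {r : ℕ}
    (h : 1 ≤ r ∨ Odd N) :
    ∃ μ : ℝ, 0 < μ ∧ HasMeanProfit N (pattern r 1 ![1, p₁, p₁, 0]) μ := by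
  obtain ⟨κ, hκ, hprofit⟩ := exists_hasMeanProfit_of_poisson hN hp r
  have hw := turnWeight_nonneg (N := N) (r := r) (param_mem_Icc hp)
  have hs := sum_turnWeight (N := N) (by omega) r ![1, p₁, p₁, 0]
  have hz : ∀ M : Set (Config N × Fin (r + 1)), M.Nonempty →
      IsClosedSet (turnWeight r ![1, p₁, p₁, 0]) (turnMap r) M →
      (alternating N false, Fin.last r) ∈ M := fun M hne hM =>
    h.elim (fun hr => alternating_false_mem (by omega) hr hp hne hM)
      fun hodd => alternating_false_mem_of_odd hodd hp hne hM
  obtain ⟨μ, v, hv⟩ := exists_poisson hw hs hz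
    fun a => if a.2 = Fin.last r then κ * discord a.1 else 0
  refine ⟨μ, poisson_const_pos hw hs (fun a => ?_) (fun M hne hM => ?_) hv, hprofit μ v hv⟩
  · split_ifs
    · exact mul_nonneg hκ.le (discord_nonneg _)
    · exact le_rfl
  · obtain ⟨x, hx, hd⟩ : ∃ x, (x, Fin.last r) ∈ M ∧ 0 < discord x :=
      h.elim (fun hr => exists_mem_discord_pos hN hr hp hne hM)
        fun hodd => ⟨_, hz M hne hM, discord_alternating_pos hodd (by omega)⟩
    refine ⟨_, hx, ?_⟩
    rw [if_pos rfl]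
    exact mul_pos hκ hd

lemma hasMeanProfit_alwaysB_of_even (hN : 3 ≤ N) (hp : p₁ ∈ Set.Ioo (1 / 2 : ℝ) 1) (h : Even N) :
    HasMeanProfit N (alwaysB ![1, p₁, p₁, 0]) 0 := by
  obtain ⟨κ, -, hprofit⟩ := exists_hasMeanProfit_of_poisson hN hp 0
  obtain ⟨v, hv⟩ := exists_poisson_of_eq_zero
    (f := fun a => if a.2 = Fin.last 0 then κ * discord a.1 else 0)
    (turnWeight_nonneg (N := N) (r := 0) (param_mem_Icc hp)) (sum_turnWeight (by omega) 0 _)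
    (isClosedSet_alternatingSet p₁)
    (fun M hne hM => by
      obtain ⟨b, hb⟩ := exists_alternating_mem (by omega) hp hne hM
      exact ⟨_, hb, alternating_mem_alternatingSet h b _⟩)
    (fun a ha => by rw [discord_eq_zero ha, mul_zero, ite_self])
  rw [alwaysB_eq_pattern]
  exact hprofit 0 v fun a => (hv a).trans (by rw [zero_add (v a)])

end Main

end CoopParrondo

theorem mainTheorem3 (N : ℕ) (hN : 3 ≤ N) (p₁ : ℝ) (hp : p₁ ∈ Set.Ioo (1 / 2 : ℝ) 1) :
    (Even N → CoopParrondo.HasMeanProfit N (CoopParrondo.alwaysB ![1, p₁, p₁, 0]) 0) ∧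
    (Odd N → ∃ μ : ℝ, 0 < μ ∧
      CoopParrondo.HasMeanProfit N (CoopParrondo.alwaysB ![1, p₁, p₁, 0]) μ) ∧
    (∀ r : ℕ, 1 ≤ r → ∃ μ : ℝ, 0 < μ ∧
      CoopParrondo.HasMeanProfit N (CoopParrondo.pattern r 1 ![1, p₁, p₁, 0]) μ) ∧
    (∀ r : ℕ, 1 ≤ r →
      (CoopParrondo.ParrondoEffect N ![1, p₁, p₁, 0] r 1 ↔ Even N)) := by
  have heven := CoopParrondo.hasMeanProfit_alwaysB_of_even hN hp
  have hodd : Odd N → ∃ μ : ℝ, 0 < μ ∧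
      CoopParrondo.HasMeanProfit N (CoopParrondo.alwaysB ![1, p₁, p₁, 0]) μ := fun h => by
    rw [CoopParrondo.alwaysB_eq_pattern]
    exact CoopParrondo.exists_pos_hasMeanProfit_pattern hN hp (Or.inr h)
  have hpat := fun r (hr : 1 ≤ r) =>
    CoopParrondo.exists_pos_hasMeanProfit_pattern (r := r) hN hp (Or.inl hr)
  refine ⟨heven, hodd, hpat, fun r hr => ⟨?_, fun h => ?_⟩⟩
  · rintro ⟨μB, -, hB, -, hle, -⟩
    by_contra hne
    obtain ⟨μ, hμ, hprofit⟩ := hodd (Nat.not_even_iff_odd.1 hne)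
    -- `ParrondoEffect` only asserts some mean `μB ≤ 0`; uniqueness identifies it with the positive
    -- mean for odd `N`.
    have := hB.unique (by omega) (fun _ => CoopParrondo.param_mem_Icc hp) hprofit
    linarith
  · obtain ⟨μ, hμ, hprofit⟩ := hpat r hr
    exact ⟨0, μ, heven h, hprofit, le_rfl, hμ⟩
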